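/- Let $n,d\ge 1$, let $f_1,\dots,f_n:\mathbb{R}^d\to\mathbb{R}$ and $f=\frac1n\sum_{j=1}^n f_j$. Suppose that $f$ is convex and twice differentiable, and that each $f_j$ is twice differentiable (but possibly nonconvex) with Lipschitz continuous gradient and Hessian: there are constants $0<L_j,\rho_j<\infty$ such that for all $\mathbf{x},\mathbf{y}\in\mathbb{R}^d$ $$\|\nabla f_j(\mathbf{x})-\nabla f_j(\mathbf{y})\|\le L_j\|\mathbf{x}-\mathbf{y}\|,\qquad \|\nabla^2 f_j(\mathbf{x})-\nabla^2 f_j(\mathbf{y})\|\le \rho_j\|\mathbf{x}-\mathbf{y}\|,$$ where $\|\cdot\|$ is the Euclidean norm for vectors and the spectral norm for matrices. Put $L=\max_j L_j$ and let $0<\epsilon,\delta<1$ and $\mathbf{x}\in\mathbb{R}^d$. Let $\mathcal{S}$ be a collection of $|\mathcal{S}|$ indices (possibly with repetitions) drawn independently and uniformly, with replacement, from $\{1,\dots,n\}$, i.e. with probabilities $p_j=\frac1n$, and let $$H(\mathbf{x})=\frac{1}{n|\mathcal{S}|}\sum_{j\in\mathcal{S}}\frac{1}{p_j}\nabla^2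 f_j(\mathbf{x})=\frac{1}{|\mathcal{S}|}\sum_{j\in\mathcal{S}}\nabla^2 f_j(\mathbf{x})$$ be the sub-sampled Hessian. If $$|\mathcal{S}|\ \ge\ \max\left\{\frac{16L^2}{\epsilon^2},\frac{4L}{\epsilon}\right\}\cdot\log\left(\frac{2d}{\delta}\right),$$ where $\log$ is the natural logarithm, then $$\mathbb{P}\left(\|H(\mathbf{x})-\nabla^2 f(\mathbf{x})\|\ge\epsilon\right)<\delta .$$ -/

import Mathlib

open MeasureTheory ProbabilityTheory

noncomputable section

namespace SubsampledHessian

/-- `ℝᵈ` with the Euclidean norm. -/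
abbrev E (d : ℕ) : Type := EuclideanSpace ℝ (Fin d)

/-- Twice differentiable on all of `ℝᵈ`: `g` is differentiable and so is its gradient. -/
def TwiceDifferentiable {d : ℕ} (g : E d → ℝ) : Prop :=
  Differentiable ℝ g ∧ Differentiable ℝ (gradient g)

/-- The Hessian of `g` at `x`, i.e. the Jacobian of the gradient, as a linear operator on `ℝᵈ`.
The norm on such operators is the operator norm for the Euclidean norm (the spectral norm). -/
def hessian {d : ℕ} (g : E d → ℝ) (x : E d) : E d →L[ℝ] E d :=
  fderiv ℝ (gradient g) x

/-- The finite-sum objective `(1/n) ∑ⱼ fⱼ`. -/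
def objective {d n : ℕ} (f : Fin n → E d → ℝ) (x : E d) : ℝ :=
  (1 / (n : ℝ)) * ∑ j, f j x

/-- The standing assumption on the finite-sum problem, with Lipschitz constants `Lip j` for the
gradients and `ρ j` for the Hessians of the (possibly nonconvex) components `f j`. -/
structure SumAssumption {d n : ℕ} (f : Fin n → E d → ℝ) (Lip ρ : Fin n → ℝ) : Prop where
  convex : ConvexOn ℝ Set.univ (objective f)
  twiceDiff : TwiceDifferentiable (objective f)
  component_twiceDiff : ∀ j, TwiceDifferentiable (f j)
  lip_pos : ∀ j, 0 < Lip j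
  rho_pos : ∀ j, 0 < ρ j
  gradient_lipschitz : ∀ j x y,
    ‖gradient (f j) x - gradient (f j) y‖ ≤ Lip j * ‖x - y‖
  hessian_lipschitz : ∀ j x y,
    ‖hessian (f j) x - hessian (f j) y‖ ≤ ρ j * ‖x - y‖

/-- `maxLip Lip = maxⱼ Lip j`. -/
def maxLip {n : ℕ} [NeZero n] (Lip : Fin n → ℝ) : ℝ :=
  Finset.univ.sup' Finset.univ_nonempty Lip

/-- `ξ 0, …, ξ (m - 1)` are `m` indices drawn from the `n` components with replacement according to
the probabilities `p`: they are independent random variables, each with law `p`. -/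
structure IsSample {Ω : Type*} [MeasurableSpace Ω] (μ : Measure Ω) {n m : ℕ}
    (p : Fin n → ℝ) (ξ : Fin m → Ω → Fin n) : Prop where
  measurable : ∀ k, Measurable (ξ k)
  indep : iIndepFun ξ μ
  law : ∀ k j, μ.real {ω | ξ k ω = j} = p j

/-- The sub-sampled Hessian `H(x) = (1 / (n |S|)) ∑_{j ∈ S} (1 / p j) ∇² f j (x)` of a sample
collection `S` of indices, repetitions allowed, listed as `S 0, …, S (m - 1)` (so `|S| = m`). -/
def subHessian {d n m : ℕ} (f : Fin n → E d → ℝ) (p : Fin n → ℝ) (S : Fin m → Fin n)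
    (x : E d) : E d →L[ℝ] E d :=
  (1 / ((n : ℝ) * (m : ℝ))) • ∑ k, (1 / p (S k)) • hessian (f (S k)) x

end SubsampledHessian

end

open MeasureTheory ProbabilityTheory
open scoped InnerProductSpace

/-! This is a matrix Chernoff argument run by counting tuples of indices. Put `l = maxLip Lip` and
`r = ε / (2 * l)`. The centred Hessians are symmetric, sum to zero and have norm at most `2 * l`.
Once they are rescaled to norm at most `r`, the bad event forces a sum of norm at least `m * r ^ 2`,
hence a large trace exponential of that sum or of its negative.

The trace exponential is controlled one sample at a time by `traceExp_add_le`, in place of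
Golden–Thompson or Lieb: a scalar Taylor bound is averaged over pairs of eigenvectors. Averaging
over the new sample kills the linear term, so each draw costs a factor `K = (1 + r ^ 2 / 3) / (1 - r
^ 2 / 6) < exp (3 * r ^ 2 / 4)` (`sum_traceExp_le`). Markov's inequality then bounds the probability
by `2 * d * K ^ m * exp (-m * r ^ 2)`, which is below `2 * d * exp (-m * ε ^ 2 / (16 * l ^ 2)) ≤ δ`.
-/

/-! ### Scalar Taylor bounds for the exponential. -/

/-- The constants come from the integral remainder: bound `exp (s * u)` by its chord on `0 ≤ s ≤ 1`;
then `∫ (1 - s) ^ 2 = 1 / 3` and `∫ s * (1 - s) = 1 / 6`. The proof instead checks convexity of the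
difference `g`. -/
theorem exp_sub_one_sub_le (u : ℝ) :
    Real.exp u - 1 - u ≤ u ^ 2 * (1 / 3 + Real.exp u / 6) := by
  set g : ℝ → ℝ := fun u => u ^ 2 * (1 / 3 + Real.exp u / 6) - (Real.exp u - 1 - u) with hg
  set g' : ℝ → ℝ := fun u => 2 * u * (1 / 3 + Real.exp u / 6) + u ^ 2 * (Real.exp u / 6)
    - (Real.exp u - 1) with hg'
  have h1 : ∀ x, HasDerivAt g (g' x) x := fun x => by
    have h := (((hasDerivAt_id x).pow 2).mul
      (((Real.hasDerivAt_exp x).div_const 6).const_add (1 / 3))).sub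
      (((Real.hasDerivAt_exp x).sub_const 1).sub (hasDerivAt_id x))
    refine HasDerivAt.congr_deriv (f := g) h ?_
    simp [hg']
  have h2 : ∀ x, HasDerivAt g' (2 / 3 + Real.exp x * (x ^ 2 / 6 + 2 * x / 3 - 2 / 3)) x :=
    fun x => by
    have h := ((((hasDerivAt_id x).const_mul 2).mul
      (((Real.hasDerivAt_exp x).div_const 6).const_add (1 / 3))).add
      (((hasDerivAt_id x).pow 2).mul ((Real.hasDerivAt_exp x).div_const 6))).sub
      ((Real.hasDerivAt_exp x).sub_const 1)
    refine HasDerivAt.congr_deriv (f := g') h ?_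
    simp
    ring
  have hmono : Monotone g' := by
    refine monotone_of_deriv_nonneg (fun x => (h2 x).differentiableAt) fun x => ?_
    rw [(h2 x).deriv]
    have e1 : Real.exp x * Real.exp (-x) = 1 := by rw [← Real.exp_add]; simp
    have e2 : 1 - x ≤ Real.exp (-x) := by linarith [Real.add_one_le_exp (-x)]
    have e3 := Real.exp_pos x
    -- The second derivative equals `2 / 3 * (1 - exp x * (1 - x)) + exp x * x ^ 2 / 6`.
    nlinarith [mul_le_mul_of_nonneg_left e2 e3.le, mul_nonneg e3.le (sq_nonneg x)]
  have h0 : g' 0 = 0 := by simp [hg']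
  have hc : Continuous g := continuous_iff_continuousAt.2 fun x => (h1 x).continuousAt
  have hg0 : g 0 = 0 := by simp [hg]
  have key : 0 ≤ g u := by
    rcases le_total 0 u with hu | hu
    · have : MonotoneOn g (Set.Ici 0) :=
        monotoneOn_of_deriv_nonneg (convex_Ici 0) hc.continuousOn
          (fun x _ => (h1 x).differentiableAt.differentiableWithinAt) fun x hx => by
            rw [(h1 x).deriv, ← h0]
            exact hmono (interior_subset hx)
      rw [← hg0]
      exact this Set.self_mem_Ici hu hu
    · have : AntitoneOn g (Set.Iic 0) :=
        antitoneOn_of_deriv_nonpos (convex_Iic 0) hc.continuousOn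
          (fun x _ => (h1 x).differentiableAt.differentiableWithinAt) fun x hx => by
            rw [(h1 x).deriv, ← h0]
            exact hmono (Set.mem_Iic.1 (interior_subset hx))
      rw [← hg0]
      exact this hu Set.self_mem_Iic hu
  simp only [hg] at key
  linarith

theorem exp_sub_exp_sub_le (s t : ℝ) :
    Real.exp t - Real.exp s - Real.exp s * (t - s) ≤
      (t - s) ^ 2 * (Real.exp s / 3 + Real.exp t / 6) := by
  have h := mul_le_mul_of_nonneg_left (exp_sub_one_sub_le (t - s)) (Real.exp_pos s).le
  have e : Real.exp t = Real.exp s * Real.exp (t - s) := by rw [← Real.exp_add]; ring_nf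
  rw [e]
  linarith

/-! ### Trace exponentials of symmetric operators. -/

section TraceExp

variable {V : Type*} [NormedAddCommGroup V] [InnerProductSpace ℝ V] [FiniteDimensional ℝ V]

theorem LinearMap.IsSymmetric.apply_eigenvectorBasis_real {T : V →ₗ[ℝ] V} (h : T.IsSymmetric)
    (i : Fin (Module.finrank ℝ V)) :
    T (h.eigenvectorBasis rfl i) = h.eigenvalues rfl i • h.eigenvectorBasis rfl i := by
  simp

open scoped Classical in
/-- `tr (exp T)` for a symmetric operator `T`, as a sum over its eigenvalues. -/
noncomputable def traceExp (T : V →ₗ[ℝ] V) : ℝ :=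
  if h : T.IsSymmetric then ∑ i, Real.exp (h.eigenvalues rfl i) else 0

open scoped Classical in
/-- `X ↦ tr (exp S * X)` for a symmetric operator `S`. -/
noncomputable def traceExpMul (S : V →ₗ[ℝ] V) : (V →ₗ[ℝ] V) →ₗ[ℝ] ℝ where
  toFun X := if h : S.IsSymmetric then ∑ i, Real.exp (h.eigenvalues rfl i) *
    ⟪h.eigenvectorBasis rfl i, X (h.eigenvectorBasis rfl i)⟫_ℝ else 0
  map_add' X Y := by
    split_ifs
    · simp [inner_add_right, mul_add, Finset.sum_add_distrib]
    · simp
  map_smul' c X := by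
    split_ifs
    · simp [inner_smul_right, Finset.mul_sum, mul_left_comm]
    · simp

theorem traceExp_nonneg (T : V →ₗ[ℝ] V) : 0 ≤ traceExp T := by
  unfold traceExp
  split_ifs <;> positivity

theorem traceExp_zero : traceExp (0 : V →ₗ[ℝ] V) = Module.finrank ℝ V := by
  have h : (0 : V →ₗ[ℝ] V).IsSymmetric := LinearMap.IsSymmetric.zero
  have h0 : ∀ i, h.eigenvalues rfl i = 0 := fun i => by
    have h1 := h.apply_eigenvectorBasis_real i
    rw [LinearMap.zero_apply, eq_comm, smul_eq_zero] at h1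
    refine h1.resolve_right ?_
    simpa using (h.eigenvectorBasis rfl).toBasis.ne_zero i
  rw [traceExp, dif_pos h]
  simp [h0]

/-- A one-step perturbation bound for `tr exp`, linear in the perturbation up to second order. -/
theorem traceExp_add_le {S X : V →ₗ[ℝ] V} (hS : S.IsSymmetric) (hX : X.IsSymmetric) {r : ℝ}
    (hr : ∀ v, ‖X v‖ ≤ r * ‖v‖) :
    (1 - r ^ 2 / 6) * traceExp (S + X) ≤ (1 + r ^ 2 / 3) * traceExp S + traceExpMul S X := by
  have hM := hS.add hX
  have eS : traceExp S = ∑ i, Real.exp (hS.eigenvalues rfl i) := by rw [traceExp, dif_pos hS]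
  have eM : traceExp (S + X) = ∑ i, Real.exp (hM.eigenvalues rfl i) := by
    rw [traceExp, dif_pos hM]
  have eX : traceExpMul S X = ∑ i, Real.exp (hS.eigenvalues rfl i) *
      ⟪hS.eigenvectorBasis rfl i, X (hS.eigenvectorBasis rfl i)⟫_ℝ := by
    simp only [traceExpMul, LinearMap.coe_mk, AddHom.coe_mk, dif_pos hS]
  rw [eS, eM, eX]
  set u := hS.eigenvectorBasis rfl
  set v := hM.eigenvectorBasis rfl
  set s := hS.eigenvalues rfl
  set t := hM.eigenvalues rfl
  have hu : ∀ i, S (u i) = s i • u i := hS.apply_eigenvectorBasis_real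
  have hv : ∀ j, (S + X) (v j) = t j • v j := hM.apply_eigenvectorBasis_real
  -- Write `X = (S + X) - S` and let each operator act on its own eigenvector.
  have hXv : ∀ i j, ⟪u i, X (v j)⟫_ℝ = (t j - s i) * ⟪u i, v j⟫_ℝ := fun i j => by
    have h1 : X (v j) = t j • v j - S (v j) := by rw [← hv j]; simp
    rw [h1, inner_sub_right, ← hS (u i) (v j), hu, inner_smul_left, inner_smul_right, sub_mul]
    simp
  have hXu : ∀ i j, ⟪v j, X (u i)⟫_ℝ = (t j - s i) * ⟪u i, v j⟫_ℝ := fun i j => by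
    rw [← hXv, ← hX, real_inner_comm]
  -- The squared overlaps form a doubly stochastic matrix; it serves as the weights for averaging
  -- the scalar bound.
  have hw1 : ∀ i, ∑ j, ⟪u i, v j⟫_ℝ ^ 2 = 1 := fun i => by
    have := v.sum_sq_inner_left (u i)
    simpa [u.norm_eq_one] using this
  have hw2 : ∀ j, ∑ i, ⟪u i, v j⟫_ℝ ^ 2 = 1 := fun j => by
    have := u.sum_sq_inner_right (v j)
    simpa [v.norm_eq_one] using this
  have hlin : ∀ i, ∑ j, ⟪u i, v j⟫_ℝ ^ 2 * (t j - s i) = ⟪u i, X (u i)⟫_ℝ := fun i => by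
    rw [← v.sum_inner_mul_inner]
    refine Finset.sum_congr rfl fun j _ => ?_
    rw [hXu]
    ring
  have hsq : ∀ w, ‖w‖ = 1 → ‖X w‖ ^ 2 ≤ r ^ 2 := fun w hw =>
    pow_le_pow_left₀ (norm_nonneg _) (by simpa [hw] using hr w) 2
  have hq1 : ∀ i, ∑ j, ⟪u i, v j⟫_ℝ ^ 2 * (t j - s i) ^ 2 ≤ r ^ 2 := fun i => by
    refine le_trans (le_of_eq ?_) (hsq (u i) (u.norm_eq_one i))
    rw [← v.sum_sq_inner_right]
    refine Finset.sum_congr rfl fun j _ => ?_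
    rw [hXu]
    ring
  have hq2 : ∀ j, ∑ i, ⟪u i, v j⟫_ℝ ^ 2 * (t j - s i) ^ 2 ≤ r ^ 2 := fun j => by
    refine le_trans (le_of_eq ?_) (hsq (v j) (v.norm_eq_one j))
    rw [← u.sum_sq_inner_right]
    refine Finset.sum_congr rfl fun i _ => ?_
    rw [hXv]
    ring
  have hmain : ∑ i, ∑ j, ⟪u i, v j⟫_ℝ ^ 2 *
      (Real.exp (t j) - Real.exp (s i) - Real.exp (s i) * (t j - s i)) ≤
      ∑ i, ∑ j, ⟪u i, v j⟫_ℝ ^ 2 *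
        ((t j - s i) ^ 2 * (Real.exp (s i) / 3 + Real.exp (t j) / 6)) := by
    gcongr with i _ j _
    exact exp_sub_exp_sub_le _ _
  have hL : ∑ i, ∑ j, ⟪u i, v j⟫_ℝ ^ 2 *
      (Real.exp (t j) - Real.exp (s i) - Real.exp (s i) * (t j - s i)) =
      ∑ j, Real.exp (t j) - ∑ i, Real.exp (s i) - ∑ i, Real.exp (s i) * ⟪u i, X (u i)⟫_ℝ := by
    have e1 : ∑ i, ∑ j, ⟪u i, v j⟫_ℝ ^ 2 * Real.exp (t j) = ∑ j, Real.exp (t j) := by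
      rw [Finset.sum_comm]
      simp only [← Finset.sum_mul, hw2, one_mul]
    have e2 : ∑ i, ∑ j, ⟪u i, v j⟫_ℝ ^ 2 * Real.exp (s i) = ∑ i, Real.exp (s i) := by
      simp only [← Finset.sum_mul, hw1, one_mul]
    have e3 : ∑ i, ∑ j, ⟪u i, v j⟫_ℝ ^ 2 * (Real.exp (s i) * (t j - s i)) =
        ∑ i, Real.exp (s i) * ⟪u i, X (u i)⟫_ℝ := by
      simp only [← hlin, Finset.mul_sum]
      exact Finset.sum_congr rfl fun i _ => Finset.sum_congr rfl fun j _ => by ring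
    simp only [mul_sub (_ ^ 2), Finset.sum_sub_distrib, e1, e2]
    rw [← e3]
  have hR : ∑ i, ∑ j, ⟪u i, v j⟫_ℝ ^ 2 *
        ((t j - s i) ^ 2 * (Real.exp (s i) / 3 + Real.exp (t j) / 6)) ≤
      r ^ 2 / 3 * ∑ i, Real.exp (s i) + r ^ 2 / 6 * ∑ j, Real.exp (t j) := by
    have e1 : ∑ i, (∑ j, ⟪u i, v j⟫_ℝ ^ 2 * (t j - s i) ^ 2) * (Real.exp (s i) / 3) ≤
        ∑ i, r ^ 2 * (Real.exp (s i) / 3) := by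
      gcongr with i _
      exact hq1 i
    have e2 : ∑ j, (∑ i, ⟪u i, v j⟫_ℝ ^ 2 * (t j - s i) ^ 2) * (Real.exp (t j) / 6) ≤
        ∑ j, r ^ 2 * (Real.exp (t j) / 6) := by
      gcongr with j _
      exact hq2 j
    have e3 : ∑ i, ∑ j, ⟪u i, v j⟫_ℝ ^ 2 *
        ((t j - s i) ^ 2 * (Real.exp (s i) / 3 + Real.exp (t j) / 6)) =
        ∑ i, (∑ j, ⟪u i, v j⟫_ℝ ^ 2 * (t j - s i) ^ 2) * (Real.exp (s i) / 3) +
        ∑ j, (∑ i, ⟪u i, v j⟫_ℝ ^ 2 * (t j - s i) ^ 2) * (Real.exp (t j) / 6) := by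
      simp only [Finset.sum_mul]
      rw [Finset.sum_comm (γ := Fin _) (f := fun j i =>
        ⟪u i, v j⟫_ℝ ^ 2 * (t j - s i) ^ 2 * (Real.exp (t j) / 6))]
      simp only [← Finset.sum_add_distrib]
      exact Finset.sum_congr rfl fun i _ => Finset.sum_congr rfl fun j _ => by ring
    rw [e3, Finset.mul_sum, Finset.mul_sum]
    refine (add_le_add e1 e2).trans (le_of_eq ?_)
    congr 1 <;> exact Finset.sum_congr rfl fun _ _ => by ring
  rw [hL] at hmain
  linarith

/-- Some basis eigenvector is not orthogonal to `w`, and symmetry forces its eigenvalue to be `c`.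
-/
theorem exp_le_traceExp {T : V →ₗ[ℝ] V} (hT : T.IsSymmetric) {c : ℝ} {w : V} (hw : w ≠ 0)
    (h : T w = c • w) : Real.exp c ≤ traceExp T := by
  obtain ⟨i, hi⟩ : ∃ i, ⟪hT.eigenvectorBasis rfl i, w⟫_ℝ ≠ 0 := by
    by_contra! h0
    refine hw ?_
    rw [← (hT.eigenvectorBasis rfl).sum_repr' w]
    simp [h0]
  have h1 : ⟪hT.eigenvectorBasis rfl i, T w⟫_ℝ = ⟪T (hT.eigenvectorBasis rfl i), w⟫_ℝ :=
    (hT _ _).symm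
  rw [hT.apply_eigenvectorBasis_real, h, inner_smul_left, inner_smul_right] at h1
  have h2 : c = hT.eigenvalues rfl i := mul_right_cancel₀ hi (by simpa using h1)
  rw [traceExp, dif_pos hT, h2]
  exact Finset.single_le_sum (f := fun i => Real.exp (hT.eigenvalues rfl i))
    (fun _ _ => (Real.exp_pos _).le) (Finset.mem_univ i)

/-- A symmetric operator of norm at least `c > 0` has an eigenvalue of absolute value at least
`c`. -/
theorem exists_eigenvector_of_le_norm {T : V →L[ℝ] V} (hT : (T : V →ₗ[ℝ] V).IsSymmetric) {c : ℝ}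
    (hc : 0 < c) (h : c ≤ ‖T‖) : ∃ (w : V) (a : ℝ), w ≠ 0 ∧ c ≤ |a| ∧ T w = a • w := by
  set u := hT.eigenvectorBasis rfl with hu
  set s := hT.eigenvalues rfl with hs
  have hTu : ∀ i, T (u i) = s i • u i := hT.apply_eigenvectorBasis_real
  by_contra! hcon
  have hlt : ∀ i, |s i| < c := fun i => by
    by_contra! hi
    exact hcon (u i) (s i) (by simpa using u.toBasis.ne_zero i) hi (hTu i)
  obtain ⟨b, hb0, hbc, hb⟩ : ∃ b, 0 ≤ b ∧ b < c ∧ ∀ i, |s i| ≤ b := by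
    rcases isEmpty_or_nonempty (Fin (Module.finrank ℝ V)) with he | he
    · exact ⟨0, le_rfl, hc, fun i => he.elim i⟩
    · obtain ⟨k, hk⟩ := Finite.exists_max fun i => |s i|
      exact ⟨|s k|, abs_nonneg _, hlt k, hk⟩
  refine absurd (ContinuousLinearMap.opNorm_le_bound T hb0 fun w => ?_) (by linarith)
  refine le_of_pow_le_pow_left₀ two_ne_zero (by positivity) ?_
  rw [← u.sum_sq_inner_right (T w), mul_pow, ← u.sum_sq_inner_right w, Finset.mul_sum]
  refine Finset.sum_le_sum fun i _ => ?_
  have h1 : ⟪u i, T w⟫_ℝ = s i * ⟪u i, w⟫_ℝ := by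
    have h2 : ⟪u i, T w⟫_ℝ = ⟪T (u i), w⟫_ℝ := (hT _ _).symm
    rw [h2, hTu, inner_smul_left]
    simp
  rw [h1, mul_pow]
  refine mul_le_mul_of_nonneg_right ?_ (sq_nonneg _)
  exact sq_le_sq' (by linarith [neg_abs_le (s i), hb i]) ((le_abs_self _).trans (hb i))

theorem exp_le_traceExp_add_traceExp_neg {T : V →L[ℝ] V} (hT : (T : V →ₗ[ℝ] V).IsSymmetric)
    {c : ℝ} (hc : 0 < c) (h : c ≤ ‖T‖) :
    Real.exp c ≤ traceExp (T : V →ₗ[ℝ] V) + traceExp (-(T : V →ₗ[ℝ] V)) := by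
  obtain ⟨w, a, hw, ha, hTw⟩ := exists_eigenvector_of_le_norm hT hc h
  rcases le_abs.1 ha with h1 | h1
  · have := exp_le_traceExp hT hw (c := a) hTw
    linarith [Real.exp_le_exp.2 h1, traceExp_nonneg (-(T : V →ₗ[ℝ] V))]
  · have := exp_le_traceExp (T := -(T : V →ₗ[ℝ] V)) (fun v w => by simpa using hT v w) hw (c := -a)
      (by simp [hTw])
    linarith [Real.exp_le_exp.2 h1, traceExp_nonneg (T : V →ₗ[ℝ] V)]

omit [FiniteDimensional ℝ V] in
theorem isSymmetric_sum {ι κ : Type*} {X : ι → V →ₗ[ℝ] V} (hX : ∀ j, (X j).IsSymmetric)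
    (s : Finset κ) (σ : κ → ι) : (∑ k ∈ s, X (σ k)).IsSymmetric := fun v w => by
  simp only [LinearMap.sum_apply, sum_inner, inner_sum]
  exact Finset.sum_congr rfl fun k _ => hX _ v w

theorem sum_traceExp_le {ι : Type*} [Fintype ι] {X : ι → V →ₗ[ℝ] V}
    (hX : ∀ j, (X j).IsSymmetric) (h0 : ∑ j, X j = 0) {r : ℝ}
    (hr : ∀ j v, ‖X j v‖ ≤ r * ‖v‖) (hr1 : r ^ 2 ≤ 1) (m : ℕ) :
    ∑ σ : Fin m → ι, traceExp (∑ k, X (σ k)) ≤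
      (Fintype.card ι * ((1 + r ^ 2 / 3) / (1 - r ^ 2 / 6))) ^ m * Module.finrank ℝ V := by
  induction m with
  | zero => simp [traceExp_zero]
  | succ m ih =>
    have hpos : 0 < 1 - r ^ 2 / 6 := by linarith
    have hstep : ∀ σ : Fin m → ι, ∑ j, traceExp (∑ k, X (σ k) + X j) ≤
        Fintype.card ι * ((1 + r ^ 2 / 3) / (1 - r ^ 2 / 6)) * traceExp (∑ k, X (σ k)) :=
      fun σ => by
      have h1 : ∑ j, (1 - r ^ 2 / 6) * traceExp (∑ k, X (σ k) + X j) ≤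
          ∑ j, ((1 + r ^ 2 / 3) * traceExp (∑ k, X (σ k)) + traceExpMul (∑ k, X (σ k)) (X j)) :=
        Finset.sum_le_sum fun j _ =>
          traceExp_add_le (isSymmetric_sum hX _ σ) (hX j) (hr j)
      -- The first-order term is linear in the perturbation, so it vanishes because the `X j` sum to
      -- zero.
      rw [← Finset.mul_sum, Finset.sum_add_distrib, ← map_sum, h0, map_zero, add_zero,
        Finset.sum_const, nsmul_eq_mul, Finset.card_univ] at h1
      have h2 : (1 + r ^ 2 / 3) / (1 - r ^ 2 / 6) * (1 - r ^ 2 / 6) = 1 + r ^ 2 / 3 :=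
        div_mul_cancel₀ _ hpos.ne'
      refine le_of_mul_le_mul_left (h1.trans (le_of_eq ?_)) hpos
      generalize (1 + r ^ 2 / 3) / (1 - r ^ 2 / 6) = K at h2 ⊢
      rw [← h2]
      ring
    rw [← (Fin.snocEquiv fun _ : Fin (m + 1) => ι).sum_comp, Fintype.sum_prod_type,
      Finset.sum_comm]
    simp only [Fin.snocEquiv, Equiv.coe_fn_mk, Fin.sum_univ_castSucc, Fin.snoc_castSucc,
      Fin.snoc_last]
    refine (Finset.sum_le_sum fun σ _ => hstep σ).trans ?_
    rw [← Finset.mul_sum, pow_succ' (_ * _), mul_assoc (_ * _)]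
    exact mul_le_mul_of_nonneg_left ih (by positivity)

end TraceExp

/-! ### Hessians of the objective and the law of the sample. -/

namespace SubsampledHessian

theorem hessian_isSymmetric {d : ℕ} {g : E d → ℝ} (hg : TwiceDifferentiable g) (x : E d) :
    (hessian g x : E d →ₗ[ℝ] E d).IsSymmetric := fun v w => by
  set A : E d →L[ℝ] (E d →L[ℝ] ℝ) := innerSL ℝ
  have h1 : ∀ y, HasFDerivAt g (A (gradient g y)) y := fun y => by
    have h := (hg.1 y).hasGradientAt.hasFDerivAt
    exact h
  have h2 : HasFDerivAt (fun y => A (gradient g y)) (A ∘L hessian g x) x :=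
    A.hasFDerivAt.comp x (hg.2 x).hasFDerivAt
  have h3 := second_derivative_symmetric h1 h2 v w
  have h4 : ⟪hessian g x v, w⟫_ℝ = ⟪hessian g x w, v⟫_ℝ := h3
  exact h4.trans (real_inner_comm _ _)

theorem gradient_objective {d n : ℕ} {f : Fin n → E d → ℝ} (hf : ∀ j, Differentiable ℝ (f j)) :
    gradient (objective f) = fun x => (1 / (n : ℝ)) • ∑ j, gradient (f j) x := by
  funext x
  have h : HasFDerivAt (objective f) ((1 / (n : ℝ)) • ∑ j, fderiv ℝ (f j) x) x :=
    (HasFDerivAt.fun_sum fun j _ => (hf j x).hasFDerivAt).const_mul _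
  simp only [gradient, h.fderiv, map_smul, map_sum]

theorem hessian_objective {d n : ℕ} {f : Fin n → E d → ℝ} (hf : ∀ j, TwiceDifferentiable (f j))
    (x : E d) : hessian (objective f) x = (1 / (n : ℝ)) • ∑ j, hessian (f j) x := by
  rw [hessian, gradient_objective fun j => (hf j).1]
  exact ((HasFDerivAt.fun_sum fun j _ => ((hf j).2 x).hasFDerivAt).const_smul (1 / (n : ℝ))).fderiv

theorem norm_hessian_le {d : ℕ} {g : E d → ℝ} {l : ℝ} (hl : 0 ≤ l)
    (h : ∀ x y, ‖gradient g x - gradient g y‖ ≤ l * ‖x - y‖) (x : E d) : ‖hessian g x‖ ≤ l :=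
  norm_fderiv_le_of_lip' ℝ hl (Filter.Eventually.of_forall fun y => h y x)

theorem subHessian_uniform {d n m : ℕ} [NeZero n] (f : Fin n → E d → ℝ) (S : Fin m → Fin n)
    (x : E d) : subHessian f (fun _ => 1 / (n : ℝ)) S x =
      (1 / (m : ℝ)) • ∑ k, hessian (f (S k)) x := by
  have hn : (n : ℝ) ≠ 0 := NeZero.ne _
  rw [subHessian, ← Finset.smul_sum, smul_smul]
  congr 1
  by_cases hm : (m : ℝ) = 0
  · simp [hm]
  · field_simp

/-- By independence all index tuples are equally likely, so probability reduces to counting. -/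
theorem IsSample.measureReal_eq {Ω : Type*} [MeasurableSpace Ω] {μ : Measure Ω}
    [IsProbabilityMeasure μ] {n m : ℕ} {ξ : Fin m → Ω → Fin n}
    (hξ : IsSample μ (fun _ : Fin n => 1 / (n : ℝ)) ξ) (B : Finset (Fin m → Fin n)) :
    μ.real {ω | (fun k => ξ k ω) ∈ B} = B.card * (1 / (n : ℝ)) ^ m := by
  have hpt : ∀ σ : Fin m → Fin n, {ω | (fun k => ξ k ω) = σ} = ⋂ k ∈ Finset.univ, ξ k ⁻¹' {σ k} :=
    fun σ => by
      ext ω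
      simp [funext_iff]
  have hmeas : ∀ σ : Fin m → Fin n, MeasurableSet {ω | (fun k => ξ k ω) = σ} := fun σ => by
    rw [hpt]
    exact Finset.measurableSet_biInter _ fun k _ => hξ.measurable k (MeasurableSet.singleton _)
  have hval : ∀ σ : Fin m → Fin n, μ.real {ω | (fun k => ξ k ω) = σ} = (1 / (n : ℝ)) ^ m :=
    fun σ => by
      rw [hpt, measureReal_def, hξ.indep.measure_inter_preimage_eq_mul _
        (fun k _ => MeasurableSet.singleton (σ k)), ENNReal.toReal_prod]
      have h : ∀ k, (μ (ξ k ⁻¹' {σ k})).toReal = 1 / (n : ℝ) := fun k => hξ.law k (σ k)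
      simp only [h, Finset.prod_const, Finset.card_univ, Fintype.card_fin]
  have hU : {ω | (fun k => ξ k ω) ∈ B} = ⋃ σ ∈ B, {ω | (fun k => ξ k ω) = σ} := by
    ext ω
    simp
  rw [hU, measureReal_biUnion_finset ?_ fun σ _ => hmeas σ]
  · simp [hval]
  · intro σ _ τ _ hne
    exact Set.disjoint_left.2 fun ω h1 h2 => hne (h1.symm.trans h2)

end SubsampledHessian

/-! ### The tail bound and the sample size. -/

/-- Matrix Hoeffding bound for sampling uniformly with replacement, in counting form. -/
theorem card_le_norm_sum_mul_exp_le {V : Type*} [NormedAddCommGroup V] [InnerProductSpace ℝ V]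
    [FiniteDimensional ℝ V] {ι : Type*} [Fintype ι] {Y : ι → V →L[ℝ] V}
    (hY : ∀ j, (Y j : V →ₗ[ℝ] V).IsSymmetric) (h0 : ∑ j, Y j = 0) {r : ℝ} (hr1 : r ^ 2 ≤ 1)
    (hr : ∀ j, ‖Y j‖ ≤ r) {m : ℕ} {c : ℝ} (hc : 0 < c) (B : Finset (Fin m → ι))
    (hB : ∀ σ ∈ B, c ≤ ‖∑ k, Y (σ k)‖) :
    B.card * Real.exp c ≤
      2 * ((Fintype.card ι * ((1 + r ^ 2 / 3) / (1 - r ^ 2 / 6))) ^ m * Module.finrank ℝ V) := by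
  have hsum : ∀ σ : Fin m → ι, ((∑ k, Y (σ k) : V →L[ℝ] V) : V →ₗ[ℝ] V) =
      ∑ k, (Y (σ k) : V →ₗ[ℝ] V) := fun σ => by
    ext v
    simp
  have h0' : ∑ j, (Y j : V →ₗ[ℝ] V) = 0 := by
    ext v
    simpa using congr($h0 v)
  have h1 := sum_traceExp_le (X := fun j => (Y j : V →ₗ[ℝ] V)) hY h0' (r := r) (fun j v => (Y j).le_of_opNorm_le (hr j) v) hr1 m
  have h2 := sum_traceExp_le (X := fun j => -(Y j : V →ₗ[ℝ] V))
    (fun j v w => by simpa using hY j v w) (by simp [h0']) (r := r)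
    (fun j v => by simpa using (Y j).le_of_opNorm_le (hr j) v) hr1 m
  have h3 : ∀ σ ∈ B, Real.exp c ≤ traceExp (∑ k, (Y (σ k) : V →ₗ[ℝ] V)) +
      traceExp (∑ k, -(Y (σ k) : V →ₗ[ℝ] V)) := fun σ hσ => by
    have hsymm := isSymmetric_sum (X := fun j => (Y j : V →ₗ[ℝ] V)) hY Finset.univ σ
    rw [← hsum] at hsymm
    rw [Finset.sum_neg_distrib, ← hsum]
    exact exp_le_traceExp_add_traceExp_neg hsymm hc (hB σ hσ)
  have h4 := (Finset.sum_le_sum h3).trans (Finset.sum_le_sum_of_subset_of_nonneg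
    (Finset.subset_univ B) fun σ _ _ => add_nonneg (traceExp_nonneg _) (traceExp_nonneg _))
  rw [Finset.sum_const, nsmul_eq_mul, Finset.sum_add_distrib] at h4
  rw [two_mul]
  exact h4.trans (add_le_add h1 h2)

theorem one_add_div_one_sub_lt_exp {a : ℝ} (h0 : 0 < a) (h1 : a ≤ 1) :
    (1 + a / 3) / (1 - a / 6) < Real.exp (3 * a / 4) := by
  rw [div_lt_iff₀ (by linarith)]
  have := Real.add_one_le_exp (3 * a / 4)
  nlinarith

theorem lemma1 {d n : ℕ} [NeZero n]
    (f : Fin n → SubsampledHessian.E d → ℝ) (Lip ρ : Fin n → ℝ)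
    (hf : SubsampledHessian.SumAssumption f Lip ρ)
    (ε δ : ℝ) (hε0 : 0 < ε) (hε1 : ε < 1) (hδ0 : 0 < δ) (hδ1 : δ < 1)
    {Ω : Type*} [MeasurableSpace Ω] (μ : Measure Ω) [IsProbabilityMeasure μ]
    {m : ℕ} (ξ : Fin m → Ω → Fin n)
    (hξ : SubsampledHessian.IsSample μ (fun _ : Fin n => 1 / (n : ℝ)) ξ)
    (hm : max (16 * SubsampledHessian.maxLip Lip ^ 2 / ε ^ 2)
        (4 * SubsampledHessian.maxLip Lip / ε) * Real.log (2 * (d : ℝ) / δ) ≤ (m : ℝ))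
    (x : SubsampledHessian.E d) :
    μ.real {ω | ε ≤ ‖SubsampledHessian.subHessian f (fun _ : Fin n => 1 / (n : ℝ))
        (fun k => ξ k ω) x
      - SubsampledHessian.hessian (SubsampledHessian.objective f) x‖} < δ := by
  classical
  open SubsampledHessian in
  set l := maxLip Lip with hl
  have hLip : ∀ j, Lip j ≤ l := fun j => Finset.le_sup' Lip (Finset.mem_univ j)
  have hlpos : 0 < l := (hf.lip_pos 0).trans_le (hLip 0)
  have hn : (0 : ℝ) < n := Nat.cast_pos.2 (NeZero.pos n)
  set H := hessian (objective f) x with hH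
  have hHsum : H = (1 / (n : ℝ)) • ∑ j, hessian (f j) x :=
    hessian_objective hf.component_twiceDiff x
  have hAj : ∀ j, ‖hessian (f j) x‖ ≤ l := fun j =>
    (norm_hessian_le (hf.lip_pos j).le (hf.gradient_lipschitz j) x).trans (hLip j)
  have hHn : ‖H‖ ≤ l := by
    rw [hHsum, norm_smul, Real.norm_of_nonneg (by positivity)]
    have : ‖∑ j, hessian (f j) x‖ ≤ n * l := by
      simpa using norm_sum_le_of_le Finset.univ fun j _ => hAj j
    calc 1 / (n : ℝ) * ‖∑ j, hessian (f j) x‖ ≤ 1 / n * (n * l) := by gcongr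
      _ = l := by field_simp
  -- For `d = 0` the logarithm takes its default value `0`, so `hm` says nothing; but all operators
  -- vanish and the event is empty.
  rcases Nat.eq_zero_or_pos d with hd | hd
  · subst hd
    have : {ω | ε ≤ ‖subHessian f (fun _ : Fin n => 1 / (n : ℝ)) (fun k => ξ k ω) x - H‖} = ∅ := by
      ext ω
      simp [hε0]
    rw [this]
    simpa using hδ0
  have hlog : 0 < Real.log (2 * (d : ℝ) / δ) := by
    refine Real.log_pos ?_
    have : (1 : ℝ) ≤ d := by exact_mod_cast hd
    rw [lt_div_iff₀ hδ0]
    linarith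
  have hm' : 16 * l ^ 2 / ε ^ 2 * Real.log (2 * (d : ℝ) / δ) ≤ m :=
    (mul_le_mul_of_nonneg_right (le_max_left _ _) hlog.le).trans hm
  have hmpos : (0 : ℝ) < m := lt_of_lt_of_le (by positivity) hm'
  set X : Fin n → E d →L[ℝ] E d := fun j => hessian (f j) x - H with hX
  have hdiff : ∀ S : Fin m → Fin n, subHessian f (fun _ : Fin n => 1 / (n : ℝ)) S x - H =
      (1 / (m : ℝ)) • ∑ k, X (S k) := fun S => by
    rw [subHessian_uniform]
    simp only [hX, Finset.sum_sub_distrib, smul_sub, Finset.sum_const, Finset.card_univ,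
      Fintype.card_fin]
    rw [← Nat.cast_smul_eq_nsmul ℝ, smul_smul, one_div_mul_cancel hmpos.ne', one_smul]
  have hXn : ∀ j, ‖X j‖ ≤ 2 * l := fun j =>
    (norm_sub_le _ _).trans (by linarith [hAj j])
  have hX0 : ∑ j, X j = 0 := by
    simp only [hX, Finset.sum_sub_distrib, Finset.sum_const, Finset.card_univ, Fintype.card_fin]
    rw [← Nat.cast_smul_eq_nsmul ℝ, hHsum, smul_smul, mul_one_div_cancel hn.ne', one_smul, sub_self]
  have hXsymm : ∀ j, (X j : E d →ₗ[ℝ] E d).IsSymmetric := fun j =>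
    (hessian_isSymmetric (hf.component_twiceDiff j) x).sub (hessian_isSymmetric hf.twiceDiff x)
  set B : Finset (Fin m → Fin n) := Finset.univ.filter fun S =>
    ε ≤ ‖subHessian f (fun _ : Fin n => 1 / (n : ℝ)) S x - H‖ with hB
  have hev : {ω | ε ≤ ‖subHessian f (fun _ : Fin n => 1 / (n : ℝ)) (fun k => ξ k ω) x - H‖} =
      {ω | (fun k => ξ k ω) ∈ B} := by
    ext ω
    simp [hB]
  rw [hev, hξ.measureReal_eq]
  have hBm : ∀ S ∈ B, m * ε ≤ ‖∑ k, X (S k)‖ := fun S hS => by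
    have h := (Finset.mem_filter.1 hS).2
    rw [hdiff, norm_smul, Real.norm_of_nonneg (by positivity), one_div_mul_eq_div,
      le_div_iff₀ hmpos] at h
    linarith
  set r := ε / (2 * l) with hr
  have hrpos : 0 < r := by positivity
  -- If `r > 1`, then `ε > 2 * l` exceeds any possible deviation.
  rcases lt_or_ge 1 r with hr1 | hr1
  · have hBe : B = ∅ := by
      refine Finset.eq_empty_of_forall_notMem fun S hS => ?_
      have h1 := hBm S hS
      have h2 : ‖∑ k, X (S k)‖ ≤ m * (2 * l) := by
        simpa using norm_sum_le_of_le Finset.univ fun k _ => hXn (S k)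
      rw [hr, lt_div_iff₀ (by positivity)] at hr1
      nlinarith
    simpa [hBe] using hδ0
  have hr2 : r ^ 2 ≤ 1 := pow_le_one₀ hrpos.le hr1
  -- This scaling turns the norm bound `2 * l` into `r` and the threshold `m * ε` into `m * r ^ 2`.
  set θ := r / (2 * l) with hθ
  have hθpos : 0 < θ := by positivity
  have hθε : θ * ε = r ^ 2 := by
    rw [hθ, hr]
    field_simp
  have hcard := card_le_norm_sum_mul_exp_le (Y := fun j => θ • X j) (r := r) (m := m)
    (c := m * r ^ 2)
    (fun j v w => by
      have h : ⟪X j v, w⟫_ℝ = ⟪v, X j w⟫_ℝ := hXsymm j v w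
      simp [inner_smul_left, inner_smul_right, h])
    (by rw [← Finset.smul_sum, hX0, smul_zero]) hr2
    (fun j => by
      rw [norm_smul, Real.norm_of_nonneg hθpos.le]
      calc θ * ‖X j‖ ≤ θ * (2 * l) := by gcongr; exact hXn j
        _ = r := by rw [hθ]; field_simp)
    (by positivity) B
    (fun S hS => by
      rw [← Finset.smul_sum, norm_smul, Real.norm_of_nonneg hθpos.le, ← hθε]
      nlinarith [hBm S hS])
  rw [Fintype.card_fin, finrank_euclideanSpace_fin] at hcard
  have hK := one_add_div_one_sub_lt_exp (a := r ^ 2) (by positivity) hr2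
  set K := (1 + r ^ 2 / 3) / (1 - r ^ 2 / 6) with hKdef
  have hK0 : 0 ≤ K := div_nonneg (by positivity) (by linarith)
  have hKm : K ^ m < Real.exp (m * (3 * r ^ 2 / 4)) := by
    rw [Real.exp_nat_mul]
    exact pow_lt_pow_left₀ hK hK0 (by exact_mod_cast hmpos.ne')
  have hδ : 2 * d ≤ δ * Real.exp (m * (r ^ 2 / 4)) := by
    have h1 : Real.log (2 * (d : ℝ) / δ) ≤ m * (r ^ 2 / 4) := by
      calc Real.log (2 * (d : ℝ) / δ)
          = 16 * l ^ 2 / ε ^ 2 * Real.log (2 * (d : ℝ) / δ) * (r ^ 2 / 4) := by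
            rw [hr]
            field_simp
            norm_num
        _ ≤ m * (r ^ 2 / 4) := by gcongr
    have h2 := (Real.log_le_iff_le_exp (by positivity)).1 h1
    rw [div_le_iff₀ hδ0] at h2
    linarith
  have hd' : (0 : ℝ) < d := Nat.cast_pos.2 hd
  have hexp : Real.exp (m * r ^ 2) =
      Real.exp (m * (r ^ 2 / 4)) * Real.exp (m * (3 * r ^ 2 / 4)) := by
    rw [← Real.exp_add]
    ring_nf
  have hnm : (0 : ℝ) < (n : ℝ) ^ m := by positivity
  have hfin : B.card * Real.exp (m * r ^ 2) < δ * n ^ m * Real.exp (m * r ^ 2) := by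
    calc B.card * Real.exp (m * r ^ 2) ≤ 2 * ((n * K) ^ m * d) := hcard
      _ = 2 * d * n ^ m * K ^ m := by rw [mul_pow]; ring
      _ < 2 * d * n ^ m * Real.exp (m * (3 * r ^ 2 / 4)) := by gcongr
      _ ≤ δ * Real.exp (m * (r ^ 2 / 4)) * n ^ m * Real.exp (m * (3 * r ^ 2 / 4)) := by gcongr
      _ = δ * n ^ m * Real.exp (m * r ^ 2) := by rw [hexp]; ring
  have := lt_of_mul_lt_mul_right hfin (Real.exp_pos _).le
  rw [one_div, inv_pow, ← div_eq_mul_inv, div_lt_iff₀ hnm]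
  exact this
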